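/- Let $p$ be a prime, let $\mathbb{Q}_p^{\mathrm{alg}}$ be an algebraic closure of $\mathbb{Q}_p$ with its $p$-adic absolute value $|\cdot|$, and let $\mathbb{C}_p$ be its completion. Let $P(X)\in\mathbb{Z}_p[[X]]$ satisfy $P(0)=0$ and $P(X)\equiv X^p \pmod{p\,\mathbb{Z}_p[[X]]}$, and let $\boldsymbol{\varpi}=(\varpi_j)_{j\ge 0}$ be a sequence in $\mathbb{Q}_p^{\mathrm{alg}}$ with $|\varpi_j|<1$ for all $j\ge 0$, $P(\varpi_0)=0$, and $P(\varpi_{j+1})=\varpi_j$ for all $j\ge 0$. For $m\ge 0$ put $$E_m(T)=\exp\Bigl(\varpi_mT+\varpi_{m-1}\frac{T^p}{p}+\cdots+\varpi_0\frac{T^{p^m}}{p^m}\Bigr)\in\mathbb{Q}_p^{\mathrm{alg}}[[T]].$$ Recall that $P$ is a Lubin--Tate series if there is a uniformizer $\mathrm{w}=pu$, $u\in\mathbb{Z}_p^\times$, with $P(X)\equiv \mathrm{w}X \pmod{X^2\mathbb{Z}_p[[X]]}$ and $P(X)\equiv X^p\pmod{\mathrm{w}\,\mathbb{Z}_p[[X]]}$.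 Let $\mathfrak{G}_P$ be the associated Lubin--Tate formal group. Let $\Lambda_{P,m}$ be the set of $x\in\mathbb{Q}_p^{\mathrm{alg}}$ with $|x|<1$ that are zeros of the $m$-th iterate of $P$. The Tate module of $\mathfrak{G}_P$ is $\varprojlim_m\Lambda_{P,m}$ (transition maps $x\mapsto P(x)$), whose elements are the sequences $(x_j)_{j\ge0}$ with $x_j\in\Lambda_{P,j+1}$ and $P(x_{j+1})=x_j$; a generator of it is such a sequence with $x_0\ne 0$. Then the following three statements are equivalent: 1. for every $m\ge 0$, the radius of convergence of $E_m(T)$ is equal to $1$; 2. for every $m\ge 0$, $E_m(T)$ converges exactly in the disk $|T|<1$, that is, for $t\in\mathbb{C}_p$ the series $E_m(t)$ converges if and only if $|t|<1$; 3. $P$ is a Lubin--Tate series and $\boldsymbol{\varpi}$ is a generator of the Tate module of $\mathfrak{G}_P$. -/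

import Mathlib

open PowerSeries

noncomputable section

namespace LubinTateExp

variable {p : ℕ} [Fact p.Prime]

/-- `HasValueAt P x y` : the series `P(x) = ∑ₙ aₙ xⁿ` converges in the algebraic closure of `ℚ_p`
(with its `p`-adic norm) and its sum is `y`. -/
def HasValueAt (P : PowerSeries ℤ_[p]) (x y : PadicAlgCl p) : Prop :=
  HasSum (fun n : ℕ => algebraMap ℚ_[p] (PadicAlgCl p) ((coeff n P : ℤ_[p]) : ℚ_[p]) * x ^ n) y

/-- `P` is a Lubin–Tate series over `ℤ_p`: for some uniformizer `w = p * u`, `u` a unit,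
`P ≡ w X mod X²` and `P ≡ X ^ p mod w`. -/
def IsLubinTateSeries (P : PowerSeries ℤ_[p]) : Prop :=
  ∃ (w : ℤ_[p]) (u : ℤ_[p]ˣ), w = (p : ℤ_[p]) * u ∧
    (X : PowerSeries ℤ_[p]) ^ 2 ∣ P - C w * X ∧ C w ∣ P - X ^ p

/-- `Λ_{P,m}`: the points `x` of the open unit disk with `P^{(m)}(x) = 0`, where `P^{(m)}` is the
`m`-th iterate of `P`. -/
def torsionPoints (P : PowerSeries ℤ_[p]) : ℕ → Set (PadicAlgCl p)
  | 0 => {0}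
  | m + 1 => {x | ‖x‖ < 1 ∧ ∃ y ∈ torsionPoints P m, HasValueAt P x y}

/-- The Tate module, the inverse limit of the `Λ_{P,m}` along `x ↦ P(x)`. Its elements are written
`(x_j)_{j ≥ 0}` with `x_j ∈ Λ_{P,j+1}` and `P(x_{j+1}) = x_j`. -/
def tateModule (P : PowerSeries ℤ_[p]) : Set (ℕ → PadicAlgCl p) :=
  {x | ∀ j, x j ∈ torsionPoints P (j + 1) ∧ HasValueAt P (x (j + 1)) (x j)}

/-- A generator of the Tate module is an element `(x_j)_{j ≥ 0}` of it with `x_0 ≠ 0`. -/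
def IsTateGenerator (P : PowerSeries ℤ_[p]) (x : ℕ → PadicAlgCl p) : Prop :=
  x ∈ tateModule P ∧ x 0 ≠ 0

/-- The polynomial `ϖ_m T + ϖ_{m-1} T^p / p + ⋯ + ϖ_0 T^{p^m} / p^m`, as a power series. -/
def expArg (ϖ : ℕ → PadicAlgCl p) (m : ℕ) : PowerSeries (PadicAlgCl p) :=
  ∑ i ∈ Finset.range (m + 1), C (ϖ (m - i) / (p : PadicAlgCl p) ^ i) * X ^ p ^ i

/-- The formal exponential
`E_m(T) = exp(ϖ_m T + ϖ_{m-1} T^p / p + ⋯ + ϖ_0 T^{p^m} / p^m)`. -/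
def expSeries (ϖ : ℕ → PadicAlgCl p) (m : ℕ) : PowerSeries (PadicAlgCl p) :=
  (PowerSeries.exp (PadicAlgCl p)).subst (expArg ϖ m)

/-- The radius of convergence of a power series over the algebraic closure of `ℚ_p`. -/
def radiusOfConvergence (f : PowerSeries (PadicAlgCl p)) : ENNReal :=
  (FormalMultilinearSeries.ofScalars (PadicAlgCl p) (fun n => coeff n f)).radius

/-- `f(T)` converges exactly in the disk `|T| < 1`: for `t ∈ ℂ_p`, the series `f(t)` converges
if and only if `|t| < 1`. -/
def ConvergesExactlyInUnitDisk (f : PowerSeries (PadicAlgCl p)) : Prop :=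
  ∀ t : ℂ_[p], Summable (fun n : ℕ => algebraMap (PadicAlgCl p) ℂ_[p] (coeff n f) * t ^ n) ↔
    ‖t‖ < 1

end LubinTateExp

end

/-!
Let `ρ = p |ϖ_0|^{p-1}`. Each of the three conditions is equivalent to `ρ ≥ 1`.

*The zeros of `P`.* Write `P = X^p + p H`. If `x ≠ 0` is a zero of `P` in the open unit disk, then
`x^{p-1} + p h₁`, with `h₁ = H'(0)`, has absolute value at most `|x| / p < 1 / p`, so
`|x|^{p-1} ≥ 1/p` if and only if `h₁` is a unit, which is the Lubin–Tate condition on `P`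
(`isLubinTateSeries_and_ne_zero_iff`). A sequence `ϖ` with `P(ϖ_{j+1}) = ϖ_j` and `P(ϖ_0) = 0` is in
the Tate module, so it generates it if and only if `ϖ_0 ≠ 0`.

*The case `ρ < 1`.* Here already `E_0 = exp(ϖ_0 T)` converges in a disk of radius greater than `1`,
by Legendre's formula for the valuation of `n!` (`exists_norm_coeff_exp_mul_pow_le`).

*Convergence in the open disk.* The coefficients of every `E_m` are integral
(`norm_coeff_expSeries_le_one`). Substitution of `P` is an endomorphism of `ℤ_p⟦X⟧` lifting the
Frobenius of `𝔽_p⟦X⟧`, so by Dwork's lemma (`exists_derivative_eq_ghostDeriv_mul`) the series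
`exp(∑ₖ P^{(k)}(X) T^{p^k} / p^k)` has coefficients in `ℤ_p⟦X⟧`, and it specializes to `E_m` at
`X = ϖ_m`, where the iterates of `P` take the values `ϖ_m, …, ϖ_0, 0, 0, …`. The specialization
takes place in the complete field `ℂ_p`, and the series are compared through their logarithmic
derivatives, which involve no denominators.

*Divergence on the unit circle when `ρ ≥ 1`.* The functional equation
`E_{m+1}(T)^p = exp(p ϖ_{m+1} T) E_m(T^p)`, in which the first factor and its inverse converge on
the closed unit disk, shows that if the coefficients of `E_{m+1}` tend to `0`, then so do those of
`E_m` (`isRestricted_expSeries_of_succ`). Thus it suffices that the coefficients of `E_0` do not,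
and those in the degrees `p^k` are bounded below (`not_isRestricted_exp`).
-/

open PowerSeries

namespace LubinTateExp

/-! ### Formal exponentials -/

section Formal

/-- A linear differential equation `f' = u f` determines `f` from its constant coefficient. -/
theorem eq_of_derivative_eq_mul {R : Type*} [CommRing R] [IsAddTorsionFree R] {u f g : R⟦X⟧}
    (hf : d⁄dX R f = u * f) (hg : d⁄dX R g = u * g)
    (h0 : constantCoeff f = constantCoeff g) : f = g := by
  ext n
  induction n using Nat.strong_induction_on with
  | _ n ih =>
    cases n with
    | zero => simpa using h0
    | succ n =>
      have hfn := congrArg (coeff n) hf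
      have hgn := congrArg (coeff n) hg
      rw [coeff_derivative, coeff_mul] at hfn hgn
      have hsum : ∑ q ∈ Finset.HasAntidiagonal.antidiagonal n, coeff q.1 u * coeff q.2 f =
          ∑ q ∈ Finset.HasAntidiagonal.antidiagonal n, coeff q.1 u * coeff q.2 g := by
        refine Finset.sum_congr rfl fun q hq ↦ ?_
        rw [ih q.2 (Nat.lt_succ_of_le (Finset.HasAntidiagonal.antidiagonal.snd_le hq))]
      rw [hsum, ← hgn] at hfn
      have h : (n + 1) • coeff (n + 1) f = (n + 1) • coeff (n + 1) g := by
        simpa [nsmul_eq_mul, mul_comm] using hfn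
      exact (smul_right_inj (Nat.succ_ne_zero n)).mp h

theorem derivative_map {R S : Type*} [CommRing R] [CommRing S] (h : R →+* S) (f : R⟦X⟧) :
    d⁄dX S (map h f) = map h (d⁄dX R f) := by
  ext n
  simp [coeff_derivative]

variable {K : Type*} [Field K] [Algebra ℚ K]

theorem isAddTorsionFree_of_algebraRat (K : Type*) [Field K] [Algebra ℚ K] :
    IsAddTorsionFree K := by
  have : CharZero K := algebraRat.charZero K
  infer_instance

theorem constantCoeff_exp_subst {g : K⟦X⟧} (hg : constantCoeff g = 0) :
    constantCoeff ((exp K).subst g) = 1 := by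
  rw [← coeff_zero_eq_constantCoeff_apply, coeff_subst' (HasSubst.of_constantCoeff_zero' hg)]
  rw [finsum_eq_single _ 0]
  · simp
  · intro n hn
    simp [hg, hn]

theorem derivative_exp_subst {g : K⟦X⟧} (hg : constantCoeff g = 0) :
    d⁄dX K ((exp K).subst g) = d⁄dX K g * (exp K).subst g := by
  rw [derivative_subst (HasSubst.of_constantCoeff_zero' hg), derivative_exp, mul_comm]

theorem exp_subst_add {f g : K⟦X⟧} (hf : constantCoeff f = 0) (hg : constantCoeff g = 0) :
    (exp K).subst (f + g) = (exp K).subst f * (exp K).subst g := by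
  have := isAddTorsionFree_of_algebraRat K
  refine eq_of_derivative_eq_mul (derivative_exp_subst (by simp [hf, hg])) ?_ ?_
  · rw [Derivation.leibniz, derivative_exp_subst hf, derivative_exp_subst hg, map_add]
    simp only [smul_eq_mul]
    ring
  · rw [map_mul, constantCoeff_exp_subst hf, constantCoeff_exp_subst hg,
      constantCoeff_exp_subst (by simp [hf, hg]), mul_one]

theorem exp_subst_nsmul {g : K⟦X⟧} (hg : constantCoeff g = 0) (n : ℕ) :
    (exp K).subst (n • g) = (exp K).subst g ^ n := by
  induction n with
  | zero => simp [subst_zero_eq_C_constantCoeff]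
  | succ n ih => rw [succ_nsmul, exp_subst_add (by simp [hg]) hg, ih, pow_succ]

theorem coeff_exp_subst_C_mul_X (a : K) (n : ℕ) :
    coeff n ((exp K).subst (C a * X : K⟦X⟧)) = a ^ n / (n.factorial : K) := by
  rw [← smul_eq_C_mul, ← rescale_eq_subst, coeff_rescale, coeff_exp]
  simp [div_eq_mul_inv]

/-- The series `∑ₖ φₖ T^{p^k} / p^k`. Its coefficient in degree `n` is nonzero only if `n` is a
power of `p`, which is expressed by `p ^ Nat.log p n = n`. -/
def ghostLog (p : ℕ) (φ : ℕ → K) : K⟦X⟧ :=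
  mk fun n ↦ if p ^ Nat.log p n = n then φ (Nat.log p n) / (n : K) else 0

/-- The series `∑ₖ φₖ T^{p^k - 1}`, the derivative of `ghostLog p φ`; it makes sense without
denominators. -/
def ghostDeriv {R : Type*} [CommRing R] (p : ℕ) (φ : ℕ → R) : R⟦X⟧ :=
  mk fun n ↦ if p ^ Nat.log p (n + 1) = n + 1 then φ (Nat.log p (n + 1)) else 0

theorem map_ghostDeriv {R S : Type*} [CommRing R] [CommRing S] (f : R →+* S) (p : ℕ)
    (φ : ℕ → R) : map f (ghostDeriv p φ) = ghostDeriv p fun k ↦ f (φ k) := by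
  ext n
  simp only [ghostDeriv, coeff_map, coeff_mk]
  split_ifs <;> simp

theorem constantCoeff_ghostLog {K : Type*} [Field K] (p : ℕ) (φ : ℕ → K) :
    constantCoeff (ghostLog p φ) = 0 := by
  rw [← coeff_zero_eq_constantCoeff_apply]
  simp [ghostLog]

theorem derivative_ghostLog (p : ℕ) (φ : ℕ → K) :
    d⁄dX K (ghostLog p φ) = ghostDeriv p φ := by
  have : CharZero K := algebraRat.charZero K
  ext n
  rw [coeff_derivative]
  simp only [ghostLog, ghostDeriv, coeff_mk]
  have hn : (n : K) + 1 ≠ 0 := by exact_mod_cast Nat.succ_ne_zero n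
  split_ifs
  · push_cast
    field_simp
  · simp

theorem nsmul_ghostLog {p : ℕ} (hp : p.Prime) (φ : ℕ → K) :
    p • ghostLog p φ = C (p * φ 0) * X + expand p hp.ne_zero (ghostLog p fun k ↦ φ (k + 1)) := by
  have : CharZero K := algebraRat.charZero K
  have hpK : (p : K) ≠ 0 := by exact_mod_cast hp.ne_zero
  ext n
  rw [map_nsmul, map_add, coeff_C_mul, coeff_X, coeff_expand, nsmul_eq_mul]
  simp only [ghostLog, coeff_mk]
  by_cases hpn : p ∣ n
  · obtain ⟨m, rfl⟩ := hpn
    have h1 : p * m ≠ 1 := fun h ↦ hp.one_lt.ne' (Nat.eq_one_of_mul_eq_one_right h)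
    rw [if_pos (dvd_mul_right p m), Nat.mul_div_cancel_left m hp.pos]
    simp only [h1, if_false, mul_zero, zero_add]
    rcases Nat.eq_zero_or_pos m with rfl | hm
    · simp
    · have hlog : Nat.log p (p * m) = Nat.log p m + 1 := by
        rw [mul_comm, Nat.log_mul_base hp.one_lt hm.ne']
      have hmK : (m : K) ≠ 0 := by exact_mod_cast hm.ne'
      simp only [hlog, pow_succ', Nat.mul_right_inj hp.ne_zero]
      split_ifs
      · push_cast
        field_simp
      · simp
  · by_cases h1 : n = 1
    · subst h1
      simp [hp.one_lt.ne']
    · have : p ^ Nat.log p n ≠ n := by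
        intro h
        rcases Nat.eq_zero_or_pos (Nat.log p n) with h0 | h0
        · rw [h0, pow_zero] at h
          exact h1 h.symm
        · exact hpn (h ▸ dvd_pow_self p h0.ne')
      simp [this, h1, hpn]

/-- The functional equation `E_φ(T)^p = exp(p φ₀ T) E_{φ'}(T^p)` of `E_φ = exp(∑ φₖ T^{p^k} / p^k)`,
where `φ'` is the shifted sequence. -/
theorem exp_ghostLog_pow {p : ℕ} (hp : p.Prime) (φ : ℕ → K) :
    (exp K).subst (ghostLog p φ) ^ p = (exp K).subst (C (p * φ 0) * X : K⟦X⟧) *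
      expand p hp.ne_zero ((exp K).subst (ghostLog p fun k ↦ φ (k + 1))) := by
  have h := constantCoeff_ghostLog p fun k ↦ φ (k + 1)
  rw [← exp_subst_nsmul (constantCoeff_ghostLog p φ), nsmul_ghostLog hp,
    exp_subst_add (by simp) (by rw [constantCoeff_expand, h])]
  congr 1
  exact (expand_subst (τ := Unit) p hp.ne_zero (HasSubst.of_constantCoeff_zero' h) _).symm

end Formal

/-! ### Integrality of exponentials attached to a Frobenius lift -/

section Dwork

variable {A : Type*} [CommRing A] {p : ℕ}

theorem C_dvd_iff_forall_coeff {a : A} {f : A⟦X⟧} : C a ∣ f ↔ ∀ n, a ∣ coeff n f := by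
  constructor
  · rintro ⟨g, rfl⟩ n
    rw [coeff_C_mul]
    exact dvd_mul_right _ _
  · intro h
    choose g hg using h
    exact ⟨mk g, by ext n; rw [coeff_C_mul, coeff_mk, hg]⟩

theorem C_dvd_iff_map_quotient_eq_zero {a : A} {f : A⟦X⟧} :
    C a ∣ f ↔ map (Ideal.Quotient.mk (Ideal.span {a})) f = 0 := by
  simp only [C_dvd_iff_forall_coeff, PowerSeries.ext_iff, coeff_map, map_zero,
    Ideal.Quotient.eq_zero_iff_dvd]

/-- If `σ` lifts the Frobenius of `A / p`, then `f^σ(T^p) ≡ f(T)^p` modulo `p`. -/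
theorem C_dvd_expand_map_sub_pow (hp : p.Prime) {σ : A →+* A}
    (hσ : ∀ a, (p : A) ∣ σ a - a ^ p) (f : A⟦X⟧) :
    C (p : A) ∣ expand p hp.ne_zero (map σ f) - f ^ p := by
  by_cases hu : IsUnit (p : A)
  · exact (hu.map C).dvd
  have : Fact p.Prime := ⟨hp⟩
  have : CharP (A ⧸ Ideal.span {(p : A)}) p := CharP.quotient A p hu
  set π := Ideal.Quotient.mk (Ideal.span {(p : A)}) with hπ
  have hcomp : map π (map σ f) = map (frobenius _ p) (map π f) := by
    ext n
    simp only [coeff_map, frobenius_def]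
    rw [← map_pow, ← sub_eq_zero, ← map_sub, Ideal.Quotient.eq_zero_iff_dvd]
    exact hσ _
  rw [C_dvd_iff_map_quotient_eq_zero, map_sub, map_expand, hcomp, ← map_expand, map_pow,
    sub_eq_zero]
  exact MvPowerSeries.map_frobenius_expand p hp.ne_zero

/-- In the `k`-th power of a series with constant coefficient `1`, the coefficient of `Tⁿ` depends
on the `n`-th coefficient of the series through the summand `k aₙ` only; `g` is the series with
that coefficient removed. -/
theorem coeff_pow_eq_of_coeff_eq_of_lt {f g : A⟦X⟧} {n : ℕ} (hn : n ≠ 0)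
    (h : ∀ i < n, coeff i f = coeff i g) (hg0 : constantCoeff g = 1) (hgn : coeff n g = 0)
    (k : ℕ) : coeff n (f ^ k) = coeff n (g ^ k) + k * coeff n f := by
  have hdvd : X ^ n ∣ f - g := X_pow_dvd_iff.mpr fun i hi ↦ by rw [map_sub, h i hi, sub_self]
  obtain ⟨r, hr⟩ := hdvd
  have hr0 : constantCoeff r = coeff n f := by
    have := congrArg (coeff n) hr
    rw [map_sub, hgn, sub_zero] at this
    rw [this, ← coeff_zero_eq_constantCoeff_apply]
    simpa using (coeff_X_pow_mul r n 0).symm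
  have hf : f = g + X ^ n * r := by rw [← hr]; ring
  have key : ∀ k : ℕ, ∃ s : A⟦X⟧, f ^ k = g ^ k + X ^ n * s ∧
      constantCoeff s = k * coeff n f := by
    intro k
    induction k with
    | zero => exact ⟨0, by simp, by simp⟩
    | succ k ih =>
      obtain ⟨s, hs, hs0⟩ := ih
      refine ⟨s * g + X ^ n * s * r + g ^ k * r, ?_, ?_⟩
      · rw [pow_succ, hs, hf]
        ring
      · simp [hn, hs0, hr0, hg0]
        ring
  obtain ⟨s, hs, hs0⟩ := key k
  rw [hs, map_add, ← hs0, ← coeff_zero_eq_constantCoeff_apply]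
  congr 1
  simpa using coeff_X_pow_mul s n 0

/-- The coefficients `pⁿ / n!`, `n ≥ 1`, of `exp(pT)` lie in `p ℤ_(p)`. -/
theorem mul_factorial_dvd_pow [Fact p.Prime] (hunit : ∀ n : ℕ, ¬ p ∣ n → IsUnit (n : A))
    {n : ℕ} (hn : n ≠ 0) : (p * n.factorial : A) ∣ (p : A) ^ n := by
  obtain ⟨m, hm⟩ := pow_padicValNat_dvd (p := p) (n := n.factorial)
  have hpm : ¬ p ∣ m := by
    rintro ⟨l, rfl⟩
    refine pow_succ_padicValNat_not_dvd (p := p) n.factorial_ne_zero ?_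
    exact ⟨l, by rw [pow_succ, mul_assoc]; exact hm⟩
  have hlt := padicValNat_factorial_lt_of_ne_zero p hn
  rw [hm]
  push_cast
  rw [← mul_assoc, ← pow_succ', (hunit m hpm).mul_right_dvd]
  exact pow_dvd_pow _ hlt

variable [Fact p.Prime] [IsDomain A] [CharZero A]

/-- **Dwork's lemma.** If `σ` lifts the Frobenius of `A / p` and `φₖ = σᵏ(φ₀)`, then the
series `exp(∑ₖ φₖ T^{p^k} / p^k)` has coefficients in `A`. The statement describes it without
denominators, by its logarithmic derivative. -/
theorem exists_derivative_eq_ghostDeriv_mul (hunit : ∀ n : ℕ, ¬ p ∣ n → IsUnit (n : A))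
    (σ : A →+* A) (hσ : ∀ a, (p : A) ∣ σ a - a ^ p) (φ : ℕ → A)
    (hφ : ∀ k, σ (φ k) = φ (k + 1)) :
    ∃ F : A⟦X⟧, constantCoeff F = 1 ∧ d⁄dX A F = ghostDeriv p φ * F := by
  have hp : p.Prime := Fact.out
  let K := FractionRing A
  let ι : A →+* K := algebraMap A K
  have hι : Function.Injective ι := IsFractionRing.injective A K
  have hpK : (p : K) ≠ 0 := by exact_mod_cast hp.ne_zero
  have hlog := fun ψ : ℕ → K ↦ constantCoeff_ghostLog p ψ
  set E : K⟦X⟧ := (exp K).subst (ghostLog p fun k ↦ ι (φ k)) with hE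
  set E₁ : K⟦X⟧ := (exp K).subst (ghostLog p fun k ↦ ι (φ (k + 1))) with hE₁
  have hE0 : constantCoeff E = 1 := constantCoeff_exp_subst (hlog _)
  have hE₁0 : constantCoeff E₁ = 1 := constantCoeff_exp_subst (hlog _)
  have hdE : d⁄dX K E = map ι (ghostDeriv p φ) * E := by
    rw [hE, derivative_exp_subst (hlog _), derivative_ghostLog, map_ghostDeriv]
  have hdE₁ : d⁄dX K E₁ = map (ι.comp σ) (ghostDeriv p φ) * E₁ := by
    rw [hE₁, derivative_exp_subst (hlog _), derivative_ghostLog, map_ghostDeriv]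
    simp [hφ]
  -- `exp(p φ₀ T)` has coefficients in `A` and is congruent to `1` modulo `p`.
  have hexp : ∃ h : A⟦X⟧,
      map ι (1 + C (p : A) * h) = (exp K).subst (C (p * ι (φ 0)) * X : K⟦X⟧) := by
    have : ∀ n : ℕ, ∃ c : A, n ≠ 0 → (p : A) ^ n = p * n.factorial * c := by
      intro n
      by_cases hn : n = 0
      · exact ⟨0, fun h ↦ absurd hn h⟩
      · obtain ⟨c, hc⟩ := mul_factorial_dvd_pow hunit hn
        exact ⟨c, fun _ ↦ hc⟩
    choose c hc using this
    refine ⟨mk fun n ↦ if n = 0 then 0 else c n * φ 0 ^ n, ?_⟩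
    ext n
    rw [coeff_exp_subst_C_mul_X, coeff_map, map_add, coeff_C_mul, coeff_mk, coeff_one]
    by_cases hn : n = 0
    · simp [hn]
    · have hfac : (n.factorial : K) ≠ 0 := by exact_mod_cast n.factorial_ne_zero
      have hcK : (p : K) ^ n = p * n.factorial * ι (c n) := by
        simpa using congrArg ι (hc n hn)
      rw [if_neg hn, if_neg hn, mul_pow, hcK]
      simp only [zero_add, map_mul, map_pow, map_natCast]
      rw [eq_div_iff hfac]
      ring
  obtain ⟨h, hh⟩ := hexp
  -- The coefficients of `E` are integral and `σ` carries them to those of `E₁`. Both are proved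
  -- together, since the integrality in degree `n` needs that `E₁` and `f^σ` agree in
  -- lower degrees.
  have main : ∀ n, ∃ a : A, ι a = coeff n E ∧ ι (σ a) = coeff n E₁ := by
    intro n
    induction n using Nat.strong_induction_on with
    | _ n ih =>
      by_cases hn : n = 0
      · subst hn
        exact ⟨1, by simp [hE0], by simp [hE₁0]⟩
      have ih' : ∀ i, ∃ a : A, i < n → ι a = coeff i E ∧ ι (σ a) = coeff i E₁ := by
        intro i
        by_cases hi : i < n
        · obtain ⟨a, ha⟩ := ih i hi
          exact ⟨a, fun _ ↦ ha⟩
        · exact ⟨0, fun h ↦ absurd h hi⟩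
      choose a ha using ih'
      -- Up to degree `n`, `E = f + coeff n E * T^n`; comparing the coefficients of `T^n` in
      -- `E^p = exp(p φ₀ T) E₁(T^p)` and using `f^p ≡ f^σ(T^p)` modulo `p` gives
      -- `p * coeff n E ∈ p A`.
      let f : A⟦X⟧ := mk fun i ↦ if i < n then a i else 0
      have hf : ∀ i < n, coeff i E = coeff i (map ι f) := fun i hi ↦ by
        simp [f, hi, (ha i hi).1]
      have hfn : coeff n (map ι f) = 0 := by simp [f]
      have hf0 : constantCoeff (map ι f) = 1 := by
        rw [← hE0, ← coeff_zero_eq_constantCoeff_apply, ← coeff_zero_eq_constantCoeff_apply,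
          hf 0 (Nat.pos_of_ne_zero hn)]
      have hEp := coeff_pow_eq_of_coeff_eq_of_lt hn hf hf0 hfn p
      obtain ⟨r, hr⟩ := C_dvd_expand_map_sub_pow hp hσ f
      -- The coefficients of `E₁(T^p)` up to degree `n` involve only `E₁` up to degree `n / p < n`
      have hexpand : coeff n (map ι (1 + C (p : A) * h) * expand p hp.ne_zero E₁) =
          coeff n (map ι ((1 + C (p : A) * h) * expand p hp.ne_zero (map σ f))) := by
        rw [map_mul (map ι), coeff_mul, coeff_mul]
        refine Finset.sum_congr rfl fun q hq ↦ ?_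
        congr 1
        rw [coeff_map, coeff_expand, coeff_expand]
        split_ifs with hdvd
        · have hlt : q.2 / p < n := by
            rcases Nat.eq_zero_or_pos q.2 with h0 | h0
            · rw [h0, Nat.zero_div]
              exact Nat.pos_of_ne_zero hn
            · exact (Nat.div_lt_self h0 hp.one_lt).trans_le
                (Finset.HasAntidiagonal.antidiagonal.snd_le hq)
          simp [f, hlt, (ha _ hlt).2]
        · simp
      have hprod : (1 + C (p : A) * h) * expand p hp.ne_zero (map σ f) =
          f ^ p + C (p : A) * (r + h * expand p hp.ne_zero (map σ f)) := by
        linear_combination hr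
      have hpow : coeff n (E ^ p) = coeff n (map ι f ^ p) +
          p * ι (coeff n (r + h * expand p hp.ne_zero (map σ f))) := by
        rw [exp_ghostLog_pow hp, ← hh, hexpand, hprod, map_add, map_add, map_pow, map_mul, map_C,
          coeff_C_mul, coeff_map, map_natCast]
      set b : A := coeff n (r + h * expand p hp.ne_zero (map σ f)) with hb_def
      have hb : ι b = coeff n E := by
        rw [hpow] at hEp
        exact mul_left_cancel₀ hpK (add_left_cancel hEp)
      refine ⟨b, hb, ?_⟩
      -- `σ` carries the recursion given by `hdE` to the one given by `hdE₁`.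
      obtain ⟨m, rfl⟩ := Nat.exists_eq_succ_of_ne_zero hn
      have hE' := congrArg (coeff m) hdE
      have hE₁' := congrArg (coeff m) hdE₁
      rw [coeff_derivative, coeff_mul] at hE' hE₁'
      have hrec : b * ((m : A) + 1) =
          ∑ q ∈ Finset.HasAntidiagonal.antidiagonal m, coeff q.1 (ghostDeriv p φ) * a q.2 := by
        apply hι
        rw [map_mul, hb, map_sum, map_add, map_natCast, map_one, hE']
        refine Finset.sum_congr rfl fun q hq ↦ ?_
        rw [map_mul, coeff_map,
          (ha q.2 (Nat.lt_succ_of_le (Finset.HasAntidiagonal.antidiagonal.snd_le hq))).1]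
      have hm : (m : K) + 1 ≠ 0 := by exact_mod_cast Nat.succ_ne_zero m
      apply mul_right_cancel₀ hm
      rw [hE₁']
      have := congrArg (ι.comp σ) hrec
      rw [map_mul, map_sum, map_add, map_natCast, map_one] at this
      rw [RingHom.comp_apply] at this
      rw [this]
      refine Finset.sum_congr rfl fun q hq ↦ ?_
      rw [map_mul, coeff_map, RingHom.comp_apply ι σ (a q.2),
        (ha q.2 (Nat.lt_succ_of_le (Finset.HasAntidiagonal.antidiagonal.snd_le hq))).2]
  choose a ha using main
  have hF : map ι (mk a) = E := by
    ext n
    rw [coeff_map, coeff_mk, (ha n).1]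
  refine ⟨mk a, ?_, ?_⟩
  · apply hι
    rw [map_one, ← hE0, ← hF, ← coeff_zero_eq_constantCoeff_apply,
      ← coeff_zero_eq_constantCoeff_apply, coeff_map]
  · apply map_injective ι hι
    rw [map_mul, hF, ← hdE, ← hF, derivative_map]

end Dwork

/-! ### Evaluation of power series over `ℤ_p` at points of the open unit disk -/

section Evaluation

variable {p : ℕ} [Fact p.Prime]

/-- The inclusion of `ℤ_p` in `ℂ_p`. -/
noncomputable def intToComplex (p : ℕ) [Fact p.Prime] : ℤ_[p] →+* ℂ_[p] :=
  ((algebraMap (PadicAlgCl p) ℂ_[p]).comp (algebraMap ℚ_[p] (PadicAlgCl p))).comp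
    PadicInt.Coe.ringHom

theorem norm_intToComplex (a : ℤ_[p]) : ‖intToComplex p a‖ = ‖a‖ := by
  simp only [intToComplex, RingHom.comp_apply]
  rw [← PadicComplex.coe_eq, PadicComplex.norm_extends, PadicAlgCl.norm_extends]
  rfl

theorem norm_eval_term_le (f : ℤ_[p]⟦X⟧) (x : ℂ_[p]) (n : ℕ) :
    ‖intToComplex p (coeff n f) * x ^ n‖ ≤ ‖x‖ ^ n := by
  rw [norm_mul, norm_pow, norm_intToComplex]
  exact mul_le_of_le_one_left (by positivity) (PadicInt.norm_le_one _)

theorem summable_norm_eval {x : ℂ_[p]} (hx : ‖x‖ < 1) (f : ℤ_[p]⟦X⟧) :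
    Summable fun n ↦ ‖intToComplex p (coeff n f) * x ^ n‖ :=
  Summable.of_nonneg_of_le (fun _ ↦ norm_nonneg _) (norm_eval_term_le f x)
    (summable_geometric_of_lt_one (norm_nonneg _) hx)

/-- Evaluation of power series with coefficients in `ℤ_p` at a point of the open unit disk
of `ℂ_p`. -/
noncomputable def evalHom (x : ℂ_[p]) (hx : ‖x‖ < 1) : ℤ_[p]⟦X⟧ →+* ℂ_[p] where
  toFun f := ∑' n, intToComplex p (coeff n f) * x ^ n
  map_one' := by
    rw [tsum_eq_single 0]
    · simp
    · intro n hn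
      simp [coeff_one, hn]
  map_zero' := by simp
  map_add' f g := by
    rw [← (summable_norm_eval hx f).of_norm.tsum_add (summable_norm_eval hx g).of_norm]
    simp [add_mul]
  map_mul' f g := by
    rw [tsum_mul_tsum_eq_tsum_sum_antidiagonal_of_summable_norm (summable_norm_eval hx f)
      (summable_norm_eval hx g)]
    refine tsum_congr fun n ↦ ?_
    rw [coeff_mul, map_sum, Finset.sum_mul]
    refine Finset.sum_congr rfl fun q hq ↦ ?_
    rw [← Finset.HasAntidiagonal.mem_antidiagonal.mp hq, map_mul, pow_add]
    ring

theorem evalHom_apply (x : ℂ_[p]) (hx : ‖x‖ < 1) (f : ℤ_[p]⟦X⟧) :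
    evalHom x hx f = ∑' n, intToComplex p (coeff n f) * x ^ n := rfl

theorem evalHom_C (x : ℂ_[p]) (hx : ‖x‖ < 1) (a : ℤ_[p]) :
    evalHom x hx (C a) = intToComplex p a := by
  rw [evalHom_apply, tsum_eq_single 0]
  · simp
  · intro n hn
    simp [coeff_C, hn]

theorem evalHom_X (x : ℂ_[p]) (hx : ‖x‖ < 1) : evalHom x hx X = x := by
  rw [evalHom_apply, tsum_eq_single 1]
  · simp
  · intro n hn
    simp [coeff_X, hn]

theorem norm_evalHom_le_one (x : ℂ_[p]) (hx : ‖x‖ < 1) (f : ℤ_[p]⟦X⟧) :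
    ‖evalHom x hx f‖ ≤ 1 := by
  rw [evalHom_apply]
  refine IsUltrametricDist.norm_tsum_le_of_forall_le_of_nonneg zero_le_one fun n ↦ ?_
  exact (norm_eval_term_le f x n).trans (pow_le_one₀ (norm_nonneg _) hx.le)

theorem evalHom_zero (f : ℤ_[p]⟦X⟧) :
    evalHom (0 : ℂ_[p]) (by simp) f = intToComplex p (constantCoeff f) := by
  rw [evalHom_apply, tsum_eq_single 0]
  · simp
  · intro n hn
    simp [hn]

theorem HasValueAt.evalHom_eq {P : ℤ_[p]⟦X⟧} {x y : PadicAlgCl p} (h : HasValueAt P x y)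
    (hx : ‖(x : ℂ_[p])‖ < 1) : evalHom (x : ℂ_[p]) hx P = y := by
  have := h.map (algebraMap (PadicAlgCl p) ℂ_[p]) (UniformSpace.Completion.continuous_coe _)
  rw [evalHom_apply, PadicComplex.coe_eq p y, ← this.tsum_eq]
  refine tsum_congr fun n ↦ ?_
  rw [Function.comp_apply, map_mul, map_pow]
  rfl

/-- Bounded ring homomorphisms on `ℤ_p⟦X⟧` are determined by their values on constants and at
`X`: writing `f = a + X g`, the difference on `f` is `y` times the difference on `g`, `y` the image
of `X`, hence is divisible by all powers of `y`. -/
theorem ringHom_ext_of_norm_le_one {h₁ h₂ : ℤ_[p]⟦X⟧ →+* ℂ_[p]} (hb₁ : ∀ f, ‖h₁ f‖ ≤ 1)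
    (hb₂ : ∀ f, ‖h₂ f‖ ≤ 1) (hC : ∀ a, h₁ (C a) = h₂ (C a)) (hX : h₁ X = h₂ X)
    (hlt : ‖h₂ X‖ < 1) : h₁ = h₂ := by
  have key : ∀ (N : ℕ) (f : ℤ_[p]⟦X⟧), ‖h₁ f - h₂ f‖ ≤ ‖h₂ X‖ ^ N := by
    intro N
    induction N with
    | zero =>
      intro f
      rw [pow_zero, sub_eq_add_neg]
      refine (IsUltrametricDist.norm_add_le_max _ _).trans (max_le (hb₁ f) ?_)
      rw [norm_neg]
      exact hb₂ f
    | succ N ih =>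
      intro f
      have hf := eq_X_mul_shift_add_const f
      set g : ℤ_[p]⟦X⟧ := mk fun n ↦ coeff (n + 1) f
      have : h₁ f - h₂ f = h₂ X * (h₁ g - h₂ g) := by
        rw [hf, map_add, map_add, map_mul, map_mul, hC, hX]
        ring
      rw [this, norm_mul, pow_succ']
      exact mul_le_mul_of_nonneg_left (ih g) (norm_nonneg _)
  ext f
  have h0 : ‖h₁ f - h₂ f‖ ≤ 0 :=
    ge_of_tendsto' (tendsto_pow_atTop_nhds_zero_of_lt_one (norm_nonneg _) hlt) fun N ↦ key N f
  exact sub_eq_zero.mp (norm_le_zero_iff.mp h0)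

variable {P : ℤ_[p]⟦X⟧}

/-- The endomorphism `f(X) ↦ f(P(X))` of `ℤ_p⟦X⟧`. -/
noncomputable def substHom (P : ℤ_[p]⟦X⟧) (hP0 : constantCoeff P = 0) : ℤ_[p]⟦X⟧ →+* ℤ_[p]⟦X⟧ :=
  (substAlgHom (R := ℤ_[p]) (HasSubst.of_constantCoeff_zero' hP0)).toRingHom

theorem substHom_apply (hP0 : constantCoeff P = 0) (f : ℤ_[p]⟦X⟧) :
    substHom P hP0 f = f.subst P := by
  simp [substHom, ← coe_substAlgHom (HasSubst.of_constantCoeff_zero' hP0)]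

theorem evalHom_substHom (hP0 : constantCoeff P = 0) {x y : ℂ_[p]} (hx : ‖x‖ < 1) (hy : ‖y‖ < 1)
    (hxy : evalHom x hx P = y) (f : ℤ_[p]⟦X⟧) :
    evalHom x hx (substHom P hP0 f) = evalHom y hy f := by
  have hPs := HasSubst.of_constantCoeff_zero' hP0
  refine DFunLike.congr_fun (ringHom_ext_of_norm_le_one
    (h₁ := (evalHom x hx).comp (substHom P hP0)) (h₂ := evalHom y hy)
    (fun f ↦ norm_evalHom_le_one x hx _) (norm_evalHom_le_one y hy) (fun a ↦ ?_) ?_ ?_) f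
  · rw [RingHom.comp_apply, substHom_apply, subst_C, evalHom_C]
    exact evalHom_C x hx a
  · rw [RingHom.comp_apply, substHom_apply, subst_X hPs, evalHom_X, hxy]
  · rwa [evalHom_X]

/-- As `P ≡ X^p` modulo `p`, the substitution `X ↦ P` lifts the Frobenius of `𝔽_p⟦X⟧`. -/
theorem natCast_dvd_substHom_sub_pow (hP0 : constantCoeff P = 0) (hP : C (p : ℤ_[p]) ∣ P - X ^ p)
    (f : ℤ_[p]⟦X⟧) : (p : ℤ_[p]⟦X⟧) ∣ substHom P hP0 f - f ^ p := by
  have hp : p.Prime := Fact.out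
  have hPs := HasSubst.of_constantCoeff_zero' hP0
  have hker : ∀ g : ℤ_[p]⟦X⟧, C (p : ℤ_[p]) ∣ g ↔ map PadicInt.toZMod g = 0 := by
    intro g
    rw [C_dvd_iff_forall_coeff, PowerSeries.ext_iff]
    refine forall_congr' fun n ↦ ?_
    rw [coeff_map, map_zero, ← RingHom.mem_ker, PadicInt.ker_toZMod,
      PadicInt.maximalIdeal_eq_span_p, Ideal.mem_span_singleton]
  have hPX : map PadicInt.toZMod P = X ^ p := by
    rw [hker, map_sub, sub_eq_zero] at hP
    rw [hP, map_pow, map_X]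
  rw [← map_natCast C, hker, map_sub, sub_eq_zero, substHom_apply, map_pow]
  have h1 : map PadicInt.toZMod (f.subst P) = (map PadicInt.toZMod f).subst (X ^ p) := by
    rw [← hPX]
    exact map_subst (τ := Unit) hPs f
  -- Over `𝔽_p` the Frobenius acts trivially on coefficients, so `f(X^p) = f(X)^p`.
  rw [h1, ← expand_apply p hp.ne_zero, ← MvPowerSeries.map_frobenius_expand p hp.ne_zero,
    ZMod.frobenius_zmod]
  exact (congrFun (congrArg DFunLike.coe MvPowerSeries.map_id) _).symm

/-- The sequence `ϖ_m, ϖ_{m-1}, …, ϖ_0, 0, 0, …`. -/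
def reversedSeq {K : Type*} [Zero K] (ϖ : ℕ → K) (m k : ℕ) : K := if k ≤ m then ϖ (m - k) else 0

theorem reversedSeq_zero {K : Type*} [Zero K] (ϖ : ℕ → K) (m : ℕ) : reversedSeq ϖ m 0 = ϖ m := by
  simp [reversedSeq]

theorem reversedSeq_succ_succ {K : Type*} [Zero K] (ϖ : ℕ → K) (m k : ℕ) :
    reversedSeq ϖ (m + 1) (k + 1) = reversedSeq ϖ m k := by
  simp [reversedSeq]

theorem expArg_eq_ghostLog (ϖ : ℕ → PadicAlgCl p) (m : ℕ) :
    expArg ϖ m = ghostLog p (reversedSeq ϖ m) := by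
  have hp : p.Prime := Fact.out
  ext n
  simp only [expArg, map_sum, coeff_C_mul, coeff_X_pow, mul_ite, mul_one, mul_zero, ghostLog,
    coeff_mk]
  split_ifs with hn
  · set k := Nat.log p n
    have hiff : ∀ i, n = p ^ i ↔ k = i := fun i ↦ by
      rw [← hn, Nat.pow_right_inj hp.one_lt]
    simp only [hiff, Finset.sum_ite_eq, Finset.mem_range, Nat.lt_succ_iff, reversedSeq]
    split_ifs
    · rw [← hn, Nat.cast_pow]
    · simp
  · refine Finset.sum_eq_zero fun i _ ↦ if_neg ?_
    rintro rfl
    exact hn (by rw [Nat.log_pow hp.one_lt])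

theorem expSeries_eq (ϖ : ℕ → PadicAlgCl p) (m : ℕ) :
    expSeries ϖ m = (exp (PadicAlgCl p)).subst (ghostLog p (reversedSeq ϖ m)) := by
  rw [expSeries, expArg_eq_ghostLog]

theorem derivative_expSeries (ϖ : ℕ → PadicAlgCl p) (m : ℕ) :
    d⁄dX _ (expSeries ϖ m) = ghostDeriv p (reversedSeq ϖ m) * expSeries ϖ m := by
  rw [expSeries_eq, derivative_exp_subst (constantCoeff_ghostLog _ _), derivative_ghostLog]

/-- At `ϖ_m`, the iterates `P^{(k)}(X)` take the values `ϖ_m, ϖ_{m-1}, …, ϖ_0, 0, 0, …`. -/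
theorem evalHom_iterate_substHom (hP0 : constantCoeff P = 0) {ϖ : ℕ → PadicAlgCl p}
    (hϖ_lt : ∀ j, ‖(ϖ j : ℂ_[p])‖ < 1) (hϖ_zero : HasValueAt P (ϖ 0) 0)
    (hϖ_succ : ∀ j, HasValueAt P (ϖ (j + 1)) (ϖ j)) (m k : ℕ) :
    evalHom (ϖ m : ℂ_[p]) (hϖ_lt m) ((substHom P hP0)^[k] X) =
      algebraMap (PadicAlgCl p) ℂ_[p] (reversedSeq ϖ m k) := by
  induction k generalizing m with
  | zero => rw [Function.iterate_zero_apply, evalHom_X, reversedSeq_zero, PadicComplex.coe_eq]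
  | succ k ih =>
    rw [Function.iterate_succ_apply']
    cases m with
    | zero =>
      rw [evalHom_substHom hP0 (hϖ_lt 0) (y := 0) (by simp)
        (by rw [hϖ_zero.evalHom_eq, PadicComplex.coe_zero]), evalHom_zero]
      have h0 : constantCoeff ((substHom P hP0)^[k] X) = 0 := by
        clear ih
        induction k with
        | zero => simp
        | succ k ih =>
          rw [Function.iterate_succ_apply', substHom_apply]
          exact constantCoeff_subst_eq_zero hP0 _ ih
      simp [h0, reversedSeq]
    | succ m =>
      rw [evalHom_substHom hP0 (hϖ_lt (m + 1)) (hϖ_lt m) ((hϖ_succ m).evalHom_eq _), ih,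
        reversedSeq_succ_succ]

/-- The coefficients of `E_m` are integral: Dwork's lemma for the lift `X ↦ P` of the Frobenius
gives a series over `ℤ_p⟦X⟧`, and `E_m` is its value at `X = ϖ_m`. -/
theorem norm_coeff_expSeries_le_one (hP0 : constantCoeff P = 0)
    (hP : C (p : ℤ_[p]) ∣ P - X ^ p) {ϖ : ℕ → PadicAlgCl p} (hϖ_lt : ∀ j, ‖ϖ j‖ < 1)
    (hϖ_zero : HasValueAt P (ϖ 0) 0) (hϖ_succ : ∀ j, HasValueAt P (ϖ (j + 1)) (ϖ j)) (m n : ℕ) :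
    ‖coeff n (expSeries ϖ m)‖ ≤ 1 := by
  have hlt : ∀ j, ‖(ϖ j : ℂ_[p])‖ < 1 := fun j ↦ by rw [PadicComplex.norm_extends]; exact hϖ_lt j
  have hunit : ∀ n : ℕ, ¬ p ∣ n → IsUnit (n : ℤ_[p]⟦X⟧) := by
    intro n hn
    rw [← map_natCast C]
    refine IsUnit.map C ?_
    rw [PadicInt.isUnit_iff, PadicInt.norm_natCast_eq_one_iff]
    exact (Nat.Prime.coprime_iff_not_dvd Fact.out).mpr hn
  have : CharZero ℤ_[p]⟦X⟧ := charZero_of_injective_ringHom C_injective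
  obtain ⟨F, hF0, hF⟩ := exists_derivative_eq_ghostDeriv_mul hunit (substHom P hP0)
    (natCast_dvd_substHom_sub_pow hP0 hP) (fun k ↦ (substHom P hP0)^[k] X)
    (fun k ↦ (Function.iterate_succ_apply' _ _ _).symm)
  have heq : map (algebraMap (PadicAlgCl p) ℂ_[p]) (expSeries ϖ m) =
      map (evalHom (ϖ m : ℂ_[p]) (hlt m)) F := by
    refine eq_of_derivative_eq_mul
      (u := ghostDeriv p fun k ↦ algebraMap (PadicAlgCl p) ℂ_[p] (reversedSeq ϖ m k)) ?_ ?_ ?_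
    · rw [derivative_map, derivative_expSeries, map_mul, map_ghostDeriv]
    · rw [derivative_map, hF, map_mul, map_ghostDeriv]
      simp only [evalHom_iterate_substHom hP0 hlt hϖ_zero hϖ_succ]
    · rw [← coeff_zero_eq_constantCoeff_apply, ← coeff_zero_eq_constantCoeff_apply, coeff_map,
        coeff_map, coeff_zero_eq_constantCoeff_apply, coeff_zero_eq_constantCoeff_apply, hF0,
        expSeries_eq, constantCoeff_exp_subst (constantCoeff_ghostLog _ _), map_one, map_one]
  have hn := congrArg (coeff n) heq
  rw [coeff_map, coeff_map] at hn
  rw [← PadicComplex.norm_extends, PadicComplex.coe_eq, hn]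
  exact norm_evalHom_le_one _ _ _

end Evaluation

/-! ### Growth of the coefficients of `exp(aT)` -/

section Growth

open Filter Topology

variable {p : ℕ} [Fact p.Prime]

theorem norm_natCast_prime : ‖(p : PadicAlgCl p)‖ = (p : ℝ)⁻¹ := by
  rw [← map_natCast (algebraMap ℚ_[p] (PadicAlgCl p)), PadicAlgCl.norm_extends, Padic.norm_p]

theorem norm_factorial (n : ℕ) :
    ‖(n.factorial : PadicAlgCl p)‖ = ((p : ℝ) ^ padicValNat p n.factorial)⁻¹ := by
  rw [← map_natCast (algebraMap ℚ_[p] (PadicAlgCl p)), PadicAlgCl.norm_extends,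
    Padic.norm_eq_zpow_neg_valuation (by exact_mod_cast n.factorial_ne_zero),
    Padic.valuation_natCast, zpow_neg, zpow_natCast]

/-- Legendre's formula for `n!`, applied to the coefficient `aⁿ / n!` of `exp(aT)`. -/
theorem norm_coeff_exp_pow (a : PadicAlgCl p) (n : ℕ) :
    ‖coeff n ((exp (PadicAlgCl p)).subst (C a * X : (PadicAlgCl p)⟦X⟧))‖ ^ (p - 1) =
      (‖a‖ ^ (p - 1)) ^ n * (p : ℝ) ^ (n - (p.digits n).sum) := by
  rw [coeff_exp_subst_C_mul_X, norm_div, norm_factorial, norm_pow, div_inv_eq_mul, mul_pow,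
    ← pow_mul, ← pow_mul, ← pow_mul, mul_comm n, mul_comm (padicValNat _ _),
    sub_one_mul_padicValNat_factorial]

/-- If `|a|^{p-1} < 1/p`, then `exp(aT)` converges beyond the closed unit disk. -/
theorem exists_norm_coeff_exp_mul_pow_le {a : PadicAlgCl p} (ha : ‖a‖ ^ (p - 1) * p < 1) :
    ∃ r : NNReal, 1 < r ∧
      ∀ n, ‖coeff n ((exp (PadicAlgCl p)).subst (C a * X : (PadicAlgCl p)⟦X⟧))‖ * (r : ℝ) ^ n
        ≤ 1 := by
  have hp : p.Prime := Fact.out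
  set ρ : ℝ := ‖a‖ ^ (p - 1) * p with hρ
  -- Any `r > 1` close enough to `1` for `ρ r^{p-1} < 1` will do.
  have hcont : Tendsto (fun r : NNReal ↦ ρ * (r : ℝ) ^ (p - 1)) (𝓝[>] 1) (𝓝 (ρ * 1 ^ (p - 1))) :=
    ((by fun_prop : Continuous fun r : NNReal ↦ ρ * (r : ℝ) ^ (p - 1)).tendsto' 1 _
      (by simp)).mono_left nhdsWithin_le_nhds
  rw [one_pow, mul_one] at hcont
  obtain ⟨r, hr, hr1⟩ := ((hcont.eventually_lt_const ha).and self_mem_nhdsWithin).exists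
  refine ⟨r, hr1, fun n ↦ ?_⟩
  have hp1 : (1 : ℝ) ≤ p := by exact_mod_cast hp.one_lt.le
  rw [← pow_le_one_iff_of_nonneg (by positivity) (Nat.sub_ne_zero_of_lt hp.one_lt), mul_pow,
    norm_coeff_exp_pow]
  calc (‖a‖ ^ (p - 1)) ^ n * (p : ℝ) ^ (n - (p.digits n).sum) * ((r : ℝ) ^ n) ^ (p - 1)
      ≤ (‖a‖ ^ (p - 1)) ^ n * (p : ℝ) ^ n * ((r : ℝ) ^ n) ^ (p - 1) := by
        gcongr
        exact Nat.sub_le _ _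
    _ = (ρ * (r : ℝ) ^ (p - 1)) ^ n := by
        rw [hρ, mul_pow, mul_pow, ← pow_mul (r : ℝ), ← pow_mul (r : ℝ), mul_comm n]
    _ ≤ 1 := pow_le_one₀ (by positivity) hr.le

theorem isRestricted_exp {a : PadicAlgCl p} (ha : ‖a‖ ^ (p - 1) * p < 1) :
    IsRestricted 1 ((exp (PadicAlgCl p)).subst (C a * X : (PadicAlgCl p)⟦X⟧)) := by
  obtain ⟨r, hr, hle⟩ := exists_norm_coeff_exp_mul_pow_le ha
  have hr0 : (0 : ℝ) < r := by exact_mod_cast one_pos.trans hr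
  rw [isRestricted_iff']
  refine squeeze_zero (fun n ↦ by positivity) (fun n ↦ ?_)
    (tendsto_pow_atTop_nhds_zero_of_lt_one (inv_nonneg.mpr hr0.le)
      (inv_lt_one_of_one_lt₀ (by exact_mod_cast hr)))
  rw [one_pow, mul_one, inv_pow, ← one_div, le_div_iff₀ (by positivity)]
  exact hle n

/-- If `|a|^{p-1} ≥ 1/p`, then the coefficients of `exp(aT)` in the degrees `p^k` are bounded
below. -/
theorem not_isRestricted_exp {a : PadicAlgCl p} (ha : 1 ≤ ‖a‖ ^ (p - 1) * p) :
    ¬ IsRestricted 1 ((exp (PadicAlgCl p)).subst (C a * X : (PadicAlgCl p)⟦X⟧)) := by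
  have hp : p.Prime := Fact.out
  have hp0 : (0 : ℝ) < p := by exact_mod_cast hp.pos
  intro h
  rw [isRestricted_iff'] at h
  have h' := ((h.comp (tendsto_pow_atTop_atTop_of_one_lt hp.one_lt)).pow (p - 1))
  rw [zero_pow (Nat.sub_ne_zero_of_lt hp.one_lt)] at h'
  refine absurd (ge_of_tendsto' h' fun k ↦ ?_) (not_le.mpr (inv_pos.mpr hp0))
  have hdig : (p.digits (p ^ k)).sum = 1 := by
    have := Nat.digits_base_pow_mul (k := k) hp.one_lt one_pos
    rw [mul_one] at this
    simp [this, Nat.digits_of_lt p 1 one_ne_zero hp.one_lt]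
  simp only [Function.comp_apply, one_pow, mul_one]
  rw [norm_coeff_exp_pow, hdig, inv_le_iff_one_le_mul₀ hp0, mul_assoc, ← pow_succ,
    Nat.sub_add_cancel (Nat.pow_pos hp.pos), ← mul_pow]
  exact one_le_pow₀ ha

/-- If `E_{m+1}` converges on the closed unit disk, then so does `E_m`, because
`E_m(T^p) = E_{m+1}(T)^p exp(-p ϖ_{m+1} T)` and `|p ϖ_{m+1}| < p^{-1/(p-1)}`. -/
theorem isRestricted_expSeries_of_succ {ϖ : ℕ → PadicAlgCl p} {m : ℕ} (hlt : ‖ϖ (m + 1)‖ < 1)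
    (h : IsRestricted 1 (expSeries ϖ (m + 1))) : IsRestricted 1 (expSeries ϖ m) := by
  have hp : p.Prime := Fact.out
  have hp0 : (0 : ℝ) < p := by exact_mod_cast hp.pos
  have heq := exp_ghostLog_pow hp (reversedSeq ϖ (m + 1))
  simp only [reversedSeq_succ_succ, reversedSeq_zero] at heq
  rw [← expSeries_eq, ← expSeries_eq] at heq
  set b : PadicAlgCl p := p * ϖ (m + 1) with hb
  have hinv : (exp (PadicAlgCl p)).subst (C (-b) * X : (PadicAlgCl p)⟦X⟧) *
      (exp (PadicAlgCl p)).subst (C b * X : (PadicAlgCl p)⟦X⟧) = 1 := by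
    rw [← exp_subst_add (by simp) (by simp), ← add_mul, ← map_add, neg_add_cancel]
    simp [subst_zero_eq_C_constantCoeff]
  have hbρ : ‖-b‖ ^ (p - 1) * p < 1 := by
    have hk : p - 1 ≠ 0 := Nat.sub_ne_zero_of_lt hp.one_lt
    have hpow : ‖ϖ (m + 1)‖ ^ (p - 1) < 1 := pow_lt_one₀ (norm_nonneg _) hlt hk
    have hpp : ((p : ℝ)⁻¹) ^ (p - 1) * p ≤ 1 := by
      have : ((p : ℝ)⁻¹) ^ (p - 1) ≤ (p : ℝ)⁻¹ :=
        pow_le_of_le_one (inv_nonneg.mpr hp0.le)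
          (inv_le_one_of_one_le₀ (by exact_mod_cast hp.one_lt.le)) hk
      calc _ ≤ (p : ℝ)⁻¹ * p := by gcongr
        _ = 1 := inv_mul_cancel₀ hp0.ne'
    rw [norm_neg, hb, norm_mul, norm_natCast_prime, mul_pow, mul_right_comm]
    exact mul_lt_one_of_nonneg_of_lt_one_right hpp (by positivity) hpow
  have hexpand : IsRestricted 1 (expand p hp.ne_zero (expSeries ϖ m)) := by
    have : expand p hp.ne_zero (expSeries ϖ m) =
        (exp (PadicAlgCl p)).subst (C (-b) * X : (PadicAlgCl p)⟦X⟧) * expSeries ϖ (m + 1) ^ p := by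
      rw [heq, ← mul_assoc, hinv, one_mul]
    rw [this]
    exact isRestricted.mul 1 (isRestricted_exp hbρ) (pow_mem (S := IsRestricted.subring 1) h p)
  rw [isRestricted_iff'] at hexpand ⊢
  have := hexpand.comp ((tendsto_id (α := ℕ)).const_mul_atTop' hp.pos)
  refine this.congr fun n ↦ ?_
  simp

theorem expSeries_zero (ϖ : ℕ → PadicAlgCl p) :
    expSeries ϖ 0 = (exp (PadicAlgCl p)).subst (C (ϖ 0) * X : (PadicAlgCl p)⟦X⟧) := by
  simp [expSeries, expArg]

/-- Descending from `m` to `0` reduces the divergence of `E_m` on the unit circle to that of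
`E_0 = exp(ϖ_0 T)`. -/
theorem not_isRestricted_expSeries {ϖ : ℕ → PadicAlgCl p} (hlt : ∀ j, ‖ϖ j‖ < 1)
    (h0 : 1 ≤ ‖ϖ 0‖ ^ (p - 1) * p) (m : ℕ) : ¬ IsRestricted 1 (expSeries ϖ m) := by
  induction m with
  | zero =>
    rw [expSeries_zero]
    exact not_isRestricted_exp h0
  | succ m ih => exact fun h ↦ ih (isRestricted_expSeries_of_succ (hlt _) h)

end Growth

/-! ### The size of the zeros of `P` -/

section Zeros

variable {p : ℕ} [Fact p.Prime] {P H : ℤ_[p]⟦X⟧}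

theorem coeff_eq_of_sub_X_pow_eq (hH : P - X ^ p = C (p : ℤ_[p]) * H) (n : ℕ) :
    coeff n P = (if n = p then 1 else 0) + p * coeff n H := by
  rw [← coeff_C_mul, ← hH, map_sub, coeff_X_pow]
  ring

theorem isLubinTateSeries_iff (hP0 : constantCoeff P = 0)
    (hH : P - X ^ p = C (p : ℤ_[p]) * H) : IsLubinTateSeries P ↔ IsUnit (coeff 1 H) := by
  have hp : p.Prime := Fact.out
  have hpZ : (p : ℤ_[p]) ≠ 0 := by exact_mod_cast hp.ne_zero
  have h1 : coeff 1 P = p * coeff 1 H := by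
    rw [coeff_eq_of_sub_X_pow_eq hH, if_neg hp.one_lt.ne, zero_add]
  constructor
  · rintro ⟨w, u, rfl, hX, -⟩
    have := X_pow_dvd_iff.mp hX 1 one_lt_two
    rw [map_sub, coeff_C_mul, coeff_one_X, mul_one, h1, sub_eq_zero] at this
    rw [mul_left_cancel₀ hpZ this]
    exact u.isUnit
  · rintro ⟨u, hu⟩
    refine ⟨p * u, u, rfl, X_pow_dvd_iff.mpr fun n hn ↦ ?_, ?_⟩
    · interval_cases n
      · simp [hP0]
      · simp [h1, hu]
    · rw [map_mul, (u.isUnit.map C).mul_right_dvd]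
      exact ⟨H, hH⟩

/-- In `P(x) = x^p + p ∑ hₙ xⁿ` every term other than `x^p` and `p h₁ x` is divisible
by `p x²`. -/
theorem HasValueAt.norm_pow_add_le (hP0 : constantCoeff P = 0)
    (hH : P - X ^ p = C (p : ℤ_[p]) * H) {x : PadicAlgCl p} (hx : ‖x‖ < 1)
    (h : HasValueAt P x 0) :
    ‖x ^ p + p * algebraMap ℚ_[p] (PadicAlgCl p) (coeff 1 H : ℤ_[p]) * x‖ ≤
      (p : ℝ)⁻¹ * ‖x‖ ^ 2 := by
  have hp : p.Prime := Fact.out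
  have hpZ : (p : ℤ_[p]) ≠ 0 := by exact_mod_cast hp.ne_zero
  have hH0 : coeff 0 H = 0 := by
    have := coeff_eq_of_sub_X_pow_eq hH 0
    rw [if_neg hp.ne_zero.symm, zero_add, coeff_zero_eq_constantCoeff_apply, hP0] at this
    exact (mul_eq_zero.mp this.symm).resolve_left hpZ
  set ι := algebraMap ℚ_[p] (PadicAlgCl p) with hι
  have hsum := (h.sub (hasSum_ite_eq p (x ^ p))).sub
    (hasSum_ite_eq 1 (p * ι (coeff 1 H : ℤ_[p]) * x))
  have hle : ∀ n, ‖ι ((coeff n P : ℤ_[p]) : ℚ_[p]) * x ^ n - (if n = p then x ^ p else 0) -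
      (if n = 1 then p * ι (coeff 1 H : ℤ_[p]) * x else 0)‖ ≤ (p : ℝ)⁻¹ * ‖x‖ ^ 2 := by
    intro n
    have hterm : ι ((coeff n P : ℤ_[p]) : ℚ_[p]) * x ^ n - (if n = p then x ^ p else 0) =
        p * ι (coeff n H : ℤ_[p]) * x ^ n := by
      rw [coeff_eq_of_sub_X_pow_eq hH]
      split_ifs with hn
      · subst hn
        push_cast
        rw [map_add, map_mul, map_one, map_natCast]
        ring
      · push_cast
        rw [zero_add, map_mul, map_natCast, sub_zero]
    rw [hterm]
    rcases n with _ | _ | n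
    · rw [hH0]
      simp
      positivity
    · simp
      positivity
    · rw [if_neg (by omega), sub_zero, norm_mul, norm_mul, norm_natCast_prime, hι,
        PadicAlgCl.norm_extends, norm_pow, mul_assoc]
      gcongr
      have h1 : ‖((coeff (n + 1 + 1) H : ℤ_[p]) : ℚ_[p])‖ ≤ 1 := PadicInt.norm_le_one _
      calc _ ≤ 1 * ‖x‖ ^ (n + 1 + 1) := by gcongr
        _ ≤ ‖x‖ ^ 2 := by
          rw [one_mul]
          exact pow_le_pow_of_le_one (norm_nonneg _) hx.le (by omega)
  have := IsUltrametricDist.norm_tsum_le_of_forall_le_of_nonneg (by positivity) hle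
  rwa [hsum.tsum_eq, zero_sub, ← neg_add', norm_neg] at this

/-- The dominant terms of `P(x) = 0` are `x^p` and `P'(0) x`. So a zero `x` of `P`
in the open unit disk satisfies `|x|^{p-1} ≥ 1/p` exactly when it is nonzero and `P'(0)` is a
uniformizer. -/
theorem isLubinTateSeries_and_ne_zero_iff (hP0 : constantCoeff P = 0)
    (hP : C (p : ℤ_[p]) ∣ P - X ^ p) {x : PadicAlgCl p} (hx : ‖x‖ < 1) (h : HasValueAt P x 0) :
    IsLubinTateSeries P ∧ x ≠ 0 ↔ 1 ≤ ‖x‖ ^ (p - 1) * p := by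
  obtain ⟨H, hH⟩ := hP
  have hp : p.Prime := Fact.out
  have hp0 : (0 : ℝ) < p := by exact_mod_cast hp.pos
  have hk : p - 1 ≠ 0 := Nat.sub_ne_zero_of_lt hp.one_lt
  rw [isLubinTateSeries_iff hP0 hH, ← inv_le_iff_one_le_mul₀ hp0, ← norm_pow]
  by_cases hx0 : x = 0
  · simp [hx0, hk, hp.ne_zero]
  have hnx : 0 < ‖x‖ := norm_pos_iff.mpr hx0
  set c : PadicAlgCl p := p * algebraMap ℚ_[p] (PadicAlgCl p) (coeff 1 H : ℤ_[p]) with hc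
  have hcnorm : ‖c‖ = (p : ℝ)⁻¹ * ‖coeff 1 H‖ := by
    rw [hc, norm_mul, norm_natCast_prime, PadicAlgCl.norm_extends, PadicInt.norm_def]
  have hlt : ‖x ^ (p - 1) + c‖ < (p : ℝ)⁻¹ := by
    have h1 := h.norm_pow_add_le hP0 hH hx
    have h2 : x ^ p + c * x = (x ^ (p - 1) + c) * x := by
      rw [add_mul, ← pow_succ, Nat.sub_add_cancel hp.one_lt.le]
    rw [h2, norm_mul, sq, ← mul_assoc] at h1
    refine (le_of_mul_le_mul_right h1 hnx).trans_lt ?_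
    exact mul_lt_of_lt_one_right (inv_pos.mpr hp0) hx
  simp only [ne_eq, hx0, not_false_eq_true, and_true]
  constructor
  · intro hu
    rw [PadicInt.isUnit_iff.mp hu, mul_one] at hcnorm
    by_contra! hcon
    have : ‖c‖ < (p : ℝ)⁻¹ := by
      have := IsUltrametricDist.norm_add_le_max (x ^ (p - 1) + c) (-x ^ (p - 1))
      rw [norm_neg, add_neg_cancel_comm] at this
      exact this.trans_lt (max_lt hlt hcon)
    exact this.ne hcnorm
  · intro hge
    by_contra hu
    rw [PadicInt.not_isUnit_iff] at hu
    have hc' : ‖c‖ < (p : ℝ)⁻¹ := by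
      rw [hcnorm]
      exact mul_lt_of_lt_one_right (inv_pos.mpr hp0) hu
    have := IsUltrametricDist.norm_add_le_max (x ^ (p - 1) + c) (-c)
    rw [norm_neg, add_neg_cancel_right] at this
    exact absurd (this.trans_lt (max_lt hlt hc')) (not_lt.mpr hge)

/-- A sequence as in the hypotheses always lies in the Tate module. -/
theorem isTateGenerator_iff {ϖ : ℕ → PadicAlgCl p} (hϖ_lt : ∀ j, ‖ϖ j‖ < 1)
    (hϖ_zero : HasValueAt P (ϖ 0) 0) (hϖ_succ : ∀ j, HasValueAt P (ϖ (j + 1)) (ϖ j)) :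
    IsTateGenerator P ϖ ↔ ϖ 0 ≠ 0 := by
  have hmem : ∀ j, ϖ j ∈ torsionPoints P (j + 1) := by
    intro j
    induction j with
    | zero => exact ⟨hϖ_lt 0, 0, rfl, hϖ_zero⟩
    | succ j ih => exact ⟨hϖ_lt _, ϖ j, ih, hϖ_succ j⟩
  exact ⟨fun h ↦ h.2, fun h ↦ ⟨fun j ↦ ⟨hmem j, hϖ_succ j⟩, h⟩⟩

end Zeros

/-! ### Radius of convergence and convergence on the unit circle -/

section Convergence

open Filter Topology

variable {p : ℕ} [Fact p.Prime] {f : (PadicAlgCl p)⟦X⟧}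

theorem radiusOfConvergence_eq_one (hle : ∀ n, ‖coeff n f‖ ≤ 1) (hf : ¬ IsRestricted 1 f) :
    radiusOfConvergence f = 1 := by
  refine le_antisymm ?_ ?_
  · by_contra! hlt
    refine hf ((isRestricted_iff' 1 f).mpr ?_)
    have := FormalMultilinearSeries.isLittleO_one_of_lt_radius (r := 1) _
      (by simpa [radiusOfConvergence] using hlt)
    simpa [FormalMultilinearSeries.ofScalars_norm] using
      (Asymptotics.isLittleO_one_iff ℝ).mp this
  · refine FormalMultilinearSeries.le_radius_of_bound (r := 1) _ 1 fun n ↦ ?_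
    simpa [FormalMultilinearSeries.ofScalars_norm] using hle n

theorem one_lt_radiusOfConvergence {r : NNReal} (hr : 1 < r)
    (hle : ∀ n, ‖coeff n f‖ * (r : ℝ) ^ n ≤ 1) : 1 < radiusOfConvergence f := by
  refine lt_of_lt_of_le (ENNReal.one_lt_coe_iff.mpr hr)
    (FormalMultilinearSeries.le_radius_of_bound _ 1 fun n ↦ ?_)
  simpa [FormalMultilinearSeries.ofScalars_norm] using hle n

theorem norm_algebraMap_mul_pow (a : PadicAlgCl p) (t : ℂ_[p]) (n : ℕ) :
    ‖algebraMap (PadicAlgCl p) ℂ_[p] a * t ^ n‖ = ‖a‖ * ‖t‖ ^ n := by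
  rw [norm_mul, norm_pow, ← PadicComplex.coe_eq, PadicComplex.norm_extends]

theorem convergesExactlyInUnitDisk (hle : ∀ n, ‖coeff n f‖ ≤ 1) (hf : ¬ IsRestricted 1 f) :
    ConvergesExactlyInUnitDisk f := by
  intro t
  constructor
  · intro h
    by_contra! ht
    refine hf ((isRestricted_iff' 1 f).mpr ?_)
    refine squeeze_zero (fun n ↦ by positivity) (fun n ↦ ?_)
      (tendsto_zero_iff_norm_tendsto_zero.mp h.tendsto_atTop_zero)
    rw [norm_algebraMap_mul_pow, one_pow]
    gcongr
    exact one_le_pow₀ ht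
  · intro ht
    refine Summable.of_norm_bounded (summable_geometric_of_lt_one (norm_nonneg t) ht) fun n ↦ ?_
    rw [norm_algebraMap_mul_pow]
    exact mul_le_of_le_one_left (by positivity) (hle n)

theorem not_convergesExactlyInUnitDisk {r : NNReal} (hr : 1 < r)
    (hle : ∀ n, ‖coeff n f‖ * (r : ℝ) ^ n ≤ 1) : ¬ ConvergesExactlyInUnitDisk f := by
  intro h
  have hr0 : (0 : ℝ) < r := by exact_mod_cast one_pos.trans hr
  refine absurd ((h 1).mp ?_) (by simp)
  refine Summable.of_norm_bounded (summable_geometric_of_lt_one (inv_nonneg.mpr hr0.le)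
      (inv_lt_one_of_one_lt₀ (by exact_mod_cast hr))) fun n ↦ ?_
  rw [norm_algebraMap_mul_pow, norm_one, one_pow, mul_one, inv_pow, ← one_div,
    le_div_iff₀ (by positivity)]
  exact hle n

end Convergence

end LubinTateExp

theorem mainTheorem6 (p : ℕ) [Fact p.Prime] (P : PowerSeries ℤ_[p])
    (hP0 : PowerSeries.constantCoeff P = 0)
    (hP : PowerSeries.C (p : ℤ_[p]) ∣ P - PowerSeries.X ^ p)
    (ϖ : ℕ → PadicAlgCl p)
    (hϖ_lt : ∀ j, ‖ϖ j‖ < 1)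
    (hϖ_zero : LubinTateExp.HasValueAt P (ϖ 0) 0)
    (hϖ_succ : ∀ j, LubinTateExp.HasValueAt P (ϖ (j + 1)) (ϖ j)) :
    ((∀ m, LubinTateExp.radiusOfConvergence (LubinTateExp.expSeries ϖ m) = 1) ↔
      (LubinTateExp.IsLubinTateSeries P ∧ LubinTateExp.IsTateGenerator P ϖ)) ∧
    ((∀ m, LubinTateExp.ConvergesExactlyInUnitDisk (LubinTateExp.expSeries ϖ m)) ↔
      (LubinTateExp.IsLubinTateSeries P ∧ LubinTateExp.IsTateGenerator P ϖ)) := by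
  rw [LubinTateExp.isTateGenerator_iff hϖ_lt hϖ_zero hϖ_succ,
    LubinTateExp.isLubinTateSeries_and_ne_zero_iff hP0 hP (hϖ_lt 0) hϖ_zero]
  have hint := LubinTateExp.norm_coeff_expSeries_le_one hP0 hP hϖ_lt hϖ_zero hϖ_succ
  have hsmall (h : ‖ϖ 0‖ ^ (p - 1) * p < 1) : ∃ r : NNReal, 1 < r ∧
      ∀ n, ‖PowerSeries.coeff n (LubinTateExp.expSeries ϖ 0)‖ * (r : ℝ) ^ n ≤ 1 := by
    rw [LubinTateExp.expSeries_zero]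
    exact LubinTateExp.exists_norm_coeff_exp_mul_pow_le h
  refine ⟨⟨fun h ↦ ?_, fun h m ↦ ?_⟩, ⟨fun h ↦ ?_, fun h m ↦ ?_⟩⟩
  · by_contra! hlt
    obtain ⟨r, hr, hle⟩ := hsmall hlt
    exact (LubinTateExp.one_lt_radiusOfConvergence hr hle).ne' (h 0)
  · exact LubinTateExp.radiusOfConvergence_eq_one (hint m)
      (LubinTateExp.not_isRestricted_expSeries hϖ_lt h m)
  · by_contra! hlt
    obtain ⟨r, hr, hle⟩ := hsmall hlt
    exact LubinTateExp.not_convergesExactlyInUnitDisk hr hle (h 0)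
  · exact LubinTateExp.convergesExactlyInUnitDisk (hint m)
      (LubinTateExp.not_isRestricted_expSeries hϖ_lt h m)
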